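/- Let $\mathbb{D}$ be the open unit disc of $\mathbb{C}$, let $\alpha>-1$ be real, and let $H\neq\{0\}$ be a separable complex Hilbert space. Let $\mathcal{A}^2_\alpha(H)$ be the vector-valued weighted Bergman space of all analytic functions $f:\mathbb{D}\to H$ with $$\|f\|^2=\int_{\mathbb{D}}\|f(z)\|^2\,dA_\alpha(z)<\infty,\qquad dA_\alpha(z)=(\alpha+1)(1-|z|^2)^\alpha\,dA(z),$$ where $dA=\pi^{-1}\,dx\,dy$ is the normalized area measure on $\mathbb{D}$; it is a Hilbert space with the inner product $\langle f,g\rangle=\int_{\mathbb{D}}\langle f(z),g(z)\rangle\,dA_\alpha(z)$. Let $\Phi:\mathbb{D}\to\mathbb{D}$ be analytic, and let $C_\Phi f=f\circ\Phi$ be the composition operator induced by $\Phi$ on $\mathcal{A}^2_\alpha(H)$. Then $C_\Phi$ is a co-isometry on $\mathcal{A}^2_\alpha(H)$ (that is, $C_\Phi$ is a bounded operator on $\mathcal{A}^2_\alpha(H)$ with $C_\Phi C_\Phi^*=I$) if and only if $\Phi$ is a rotation, that is, there is $\lambda\in\mathbb{C}$ with $|\lambda|=1$ such that $\Phi(z)=\lambda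 z$ for all $z\in\mathbb{D}$. -/

import Mathlib

open MeasureTheory Filter Topology
open scoped ENNReal NNReal

noncomputable section

namespace VVBergman

/-- The open unit disc of the complex plane. -/
abbrev Disc : Type := Metric.ball (0 : ℂ) 1

/-- A function on the open unit disc is analytic if it is the restriction to the disc of a function
on the plane that is (complex) analytic at every point of the disc. -/
def DiscAnalytic {X : Type*} [NormedAddCommGroup X] [NormedSpace ℂ X] (f : Disc → X) : Prop :=
  ∃ F : ℂ → X, AnalyticOnNhd ℂ F (Metric.ball 0 1) ∧ ∀ z : Disc, f z = F z

/-- The weighted area measure `dA_α(z) = (α + 1) (1 - |z|²)^α dA(z)` on the unit disc, where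
`dA = π⁻¹ dx dy` is the normalized area measure. -/
def discMeasure (α : ℝ) : Measure Disc :=
  (Measure.comap ((↑) : Disc → ℂ) volume).withDensity
    (fun z => ENNReal.ofReal ((α + 1) / Real.pi * (1 - ‖(z : ℂ)‖ ^ 2) ^ α))

section PointEvaluation

variable {H : Type*} [NormedAddCommGroup H] [NormedSpace ℂ H]

theorem DiscAnalytic.continuous {f : Disc → H} (hf : DiscAnalytic f) : Continuous f := by
  obtain ⟨F, hF, hfF⟩ := hf
  have : f = fun z : Disc => F z := funext hfF
  rw [this]
  exact hF.continuousOn.comp_continuous continuous_subtype_val (fun z => z.2)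

theorem DiscAnalytic.aestronglyMeasurable {f : Disc → H} (hf : DiscAnalytic f)
    (μ : Measure Disc) : AEStronglyMeasurable f μ :=
  hf.continuous.aestronglyMeasurable

/-- The sub-mean value property over circles. -/
theorem circle_mean_le [CompleteSpace H] {F : ℂ → H} (hF : AnalyticOnNhd ℂ F (Metric.ball 0 1))
    {z : ℂ} {r : ℝ} (hr : 0 < r) (hz : ‖z‖ + r < 1) :
    ENNReal.ofReal (2 * Real.pi) * ‖F z‖ₑ ≤
      ∫⁻ θ in Set.Ioo (-Real.pi) Real.pi, ‖F (circleMap z r θ)‖ₑ := by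
  have hsub : Metric.closedBall z |r| ⊆ Metric.ball 0 1 := by
    intro w hw
    rw [abs_of_pos hr, mem_closedBall_iff_norm] at hw
    rw [mem_ball_zero_iff]
    calc ‖w‖ = ‖z + (w - z)‖ := by congr 1; ring
      _ ≤ ‖z‖ + ‖w - z‖ := norm_add_le _ _
      _ < 1 := by linarith
  have hd : DiffContOnCl ℂ F (Metric.ball z |r|) := by
    apply DifferentiableOn.diffContOnCl
    exact (hF.differentiableOn).mono (Metric.closure_ball_subset_closedBall.trans hsub)
  have h1 := hd.circleAverage
  have hper : Function.Periodic (fun θ => F (circleMap z r θ)) (2 * Real.pi) :=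
    fun x => by simp [periodic_circleMap z r x]
  have h2 := hper.intervalIntegral_add_eq 0 (-Real.pi)
  have hpi := Real.pi_pos
  have h3 : (2 * Real.pi) • F z = ∫ θ in Set.Ioo (-Real.pi) Real.pi, F (circleMap z r θ) := by
    rw [← h1, Real.circleAverage_def, smul_smul, mul_inv_cancel₀ (by positivity), one_smul]
    rw [zero_add] at h2
    rw [h2, intervalIntegral.integral_of_le (by linarith),
      integral_Ioc_eq_integral_Ioo]
    congr 2
    ring_nf
  calc ENNReal.ofReal (2 * Real.pi) * ‖F z‖ₑ = ‖(2 * Real.pi) • F z‖ₑ := by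
        rw [enorm_smul, Real.enorm_eq_ofReal (by positivity)]
    _ ≤ _ := by rw [h3]; exact enorm_integral_le_lintegral_enorm _

/-- The sub-mean value property over discs. -/
theorem area_mean_le [CompleteSpace H] {F : ℂ → H} (hF : AnalyticOnNhd ℂ F (Metric.ball 0 1))
    {z : ℂ} {δ : ℝ} (hδ : 0 < δ) (hz : ‖z‖ + δ < 1) :
    ENNReal.ofReal (Real.pi * δ ^ 2) * ‖F z‖ₑ ≤ ∫⁻ w in Metric.ball z δ, ‖F w‖ₑ := by
  have hpi := Real.pi_pos
  set g : ℂ → ℝ≥0∞ := fun w => (Metric.ball (0 : ℂ) δ).indicator (fun w => ‖F (z + w)‖ₑ) w with hg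
  have e1 : ∫⁻ w in Metric.ball z δ, ‖F w‖ₑ = ∫⁻ w, g w := by
    rw [← lintegral_indicator Metric.isOpen_ball.measurableSet,
      ← lintegral_add_left_eq_self _ z]
    congr 1
    ext w
    simp only [hg, Set.indicator]
    simp
  have hsub : Set.Ioo (0 : ℝ) δ ×ˢ Set.Ioo (-Real.pi) Real.pi ⊆ polarCoord.target := by
    rintro ⟨r, θ⟩ ⟨h1, h2⟩
    exact ⟨h1.1, h2⟩
  have hcont : ContinuousOn (fun p : ℝ × ℝ => ENNReal.ofReal p.1 * ‖F (circleMap z p.1 p.2)‖ₑ)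
      (Set.Ioo (0 : ℝ) δ ×ˢ Set.Ioo (-Real.pi) Real.pi) := by
    have hc : Continuous (fun p : ℝ × ℝ => circleMap z p.1 p.2) := by
      unfold circleMap; fun_prop
    have h4 : ContinuousOn (fun p : ℝ × ℝ => ((Real.toNNReal p.1 * ‖F (circleMap z p.1 p.2)‖₊ :
        ℝ≥0) : ℝ≥0∞)) (Set.Ioo (0 : ℝ) δ ×ˢ Set.Ioo (-Real.pi) Real.pi) := by
      refine ENNReal.continuous_coe.comp_continuousOn (ContinuousOn.mul (by fun_prop) ?_)
      refine continuous_nnnorm.comp_continuousOn (hF.continuousOn.comp hc.continuousOn ?_)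
      rintro ⟨r, θ⟩ ⟨h1, -⟩
      rw [mem_ball_zero_iff]
      calc ‖circleMap z r θ‖ ≤ ‖z‖ + ‖circleMap 0 r θ‖ := by
            rw [← sub_add_cancel (circleMap z r θ) z, circleMap_sub_center, add_comm]
            exact norm_add_le _ _
        _ < 1 := by rw [norm_circleMap_zero, abs_of_pos h1.1]; linarith [h1.2]
    refine h4.congr fun p _ => ?_
    simp [ENNReal.ofReal, enorm]
  have hms : MeasurableSet (Set.Ioo (0 : ℝ) δ ×ˢ Set.Ioo (-Real.pi) Real.pi) :=
    measurableSet_Ioo.prod measurableSet_Ioo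
  rw [e1, ← Complex.lintegral_comp_polarCoord_symm]
  calc ENNReal.ofReal (Real.pi * δ ^ 2) * ‖F z‖ₑ
      = ∫⁻ r in Set.Ioo (0 : ℝ) δ, ENNReal.ofReal r * (ENNReal.ofReal (2 * Real.pi) * ‖F z‖ₑ) := by
        rw [lintegral_mul_const _ (by fun_prop)]
        have : ∫⁻ r in Set.Ioo (0 : ℝ) δ, ENNReal.ofReal r = ENNReal.ofReal (δ ^ 2 / 2) := by
          rw [← ofReal_integral_eq_lintegral_ofReal]
          · rw [← integral_Ioc_eq_integral_Ioo, ← intervalIntegral.integral_of_le hδ.le,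
              integral_id]
            simp
          · exact (continuous_id.integrableOn_Icc (a := (0 : ℝ)) (b := δ)).mono_set
              Set.Ioo_subset_Icc_self
          · exact (ae_restrict_mem measurableSet_Ioo).mono fun x hx => hx.1.le
        rw [this, ← mul_assoc, ← ENNReal.ofReal_mul (by positivity)]
        congr 2
        ring
    _ ≤ ∫⁻ r in Set.Ioo (0 : ℝ) δ, ∫⁻ θ in Set.Ioo (-Real.pi) Real.pi,
          ENNReal.ofReal r * ‖F (circleMap z r θ)‖ₑ := by
        refine setLIntegral_mono' measurableSet_Ioo fun r hr => ?_
        rw [lintegral_const_mul' _ _ ENNReal.ofReal_ne_top]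
        gcongr
        exact circle_mean_le hF hr.1 (by linarith [hr.2])
    _ = ∫⁻ p in Set.Ioo (0 : ℝ) δ ×ˢ Set.Ioo (-Real.pi) Real.pi,
          ENNReal.ofReal p.1 * ‖F (circleMap z p.1 p.2)‖ₑ := by
        rw [Measure.volume_eq_prod, setLIntegral_prod]
        exact hcont.aemeasurable hms
    _ = ∫⁻ p in Set.Ioo (0 : ℝ) δ ×ˢ Set.Ioo (-Real.pi) Real.pi,
          ENNReal.ofReal p.1 • g (Complex.polarCoord.symm p) := by
        refine setLIntegral_congr_fun hms fun p hp => ?_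
        have hmem : Complex.polarCoord.symm p ∈ Metric.ball (0 : ℂ) δ := by
          rw [mem_ball_zero_iff, Complex.norm_polarCoord_symm, abs_of_pos hp.1.1]
          exact hp.1.2
        simp only [hg, Set.indicator_of_mem hmem, smul_eq_mul]
        congr 3
        rw [Complex.polarCoord_symm_apply, circleMap, Complex.exp_mul_I]
        push_cast
        rfl
    _ ≤ _ := lintegral_mono_set hsub

/-- The weight is bounded below on compact subsets of the disc. -/
theorem exists_weight_lower_bound {α : ℝ} (hα : -1 < α) {ρ : ℝ} (hρ : ρ < 1) :
    ∃ c : ℝ, 0 < c ∧ ∀ w : ℂ, ‖w‖ ≤ ρ → c ≤ (α + 1) / Real.pi * (1 - ‖w‖ ^ 2) ^ α := by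
  have hpi := Real.pi_pos
  by_cases hρ0 : ρ < 0
  · exact ⟨1, one_pos, fun w hw => absurd (norm_nonneg w) (by linarith)⟩
  push Not at hρ0
  have hlt : ∀ w : ℂ, w ∈ Metric.closedBall (0 : ℂ) ρ → 0 < 1 - ‖w‖ ^ 2 := by
    intro w hw
    rw [mem_closedBall_zero_iff] at hw
    nlinarith [norm_nonneg w]
  have hc : ContinuousOn (fun w : ℂ => (α + 1) / Real.pi * (1 - ‖w‖ ^ 2) ^ α)
      (Metric.closedBall 0 ρ) := by
    refine continuousOn_const.mul (ContinuousOn.rpow_const (by fun_prop) fun w hw => ?_)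
    exact Or.inl (hlt w hw).ne'
  obtain ⟨w₀, hw₀, hmin⟩ := (isCompact_closedBall (0 : ℂ) ρ).exists_isMinOn
    ⟨0, by simpa using hρ0⟩ hc
  refine ⟨_, ?_, fun w hw => hmin (by simpa using hw)⟩
  have := Real.rpow_pos_of_pos (hlt w₀ hw₀) α
  have h1 : 0 < α + 1 := by linarith
  positivity

/-- Point evaluations are bounded, uniformly on compact subsets of the disc. -/
theorem exists_point_bound [CompleteSpace H] {α : ℝ} (hα : -1 < α) {r : ℝ} (hr : r < 1) :
    ∃ C : ℝ≥0∞, C ≠ ∞ ∧ ∀ f : Disc → H, DiscAnalytic f → ∀ z : Disc, ‖(z : ℂ)‖ ≤ r →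
      ‖f z‖ₑ ≤ C * eLpNorm f 2 (discMeasure α) := by
  have hpi := Real.pi_pos
  set δ : ℝ := (1 - r) / 2 with hδ_def
  have hδ : 0 < δ := by rw [hδ_def]; linarith
  obtain ⟨c, hc, hcw⟩ := exists_weight_lower_bound hα (ρ := r + δ) (by rw [hδ_def]; linarith)
  set K : ℝ≥0∞ := ENNReal.ofReal (Real.pi * δ ^ 2) with hK
  have hK0 : K ≠ 0 := by
    rw [hK, Ne, ENNReal.ofReal_eq_zero, not_le]; positivity
  have hKt : K ≠ ∞ := ENNReal.ofReal_ne_top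
  set c' : ℝ≥0∞ := ENNReal.ofReal c with hc'
  have hc0 : c' ≠ 0 := by rw [hc', Ne, ENNReal.ofReal_eq_zero, not_le]; exact hc
  have hct : c' ≠ ∞ := ENNReal.ofReal_ne_top
  set ν : Measure Disc := Measure.comap ((↑) : Disc → ℂ) volume with hν
  have hemb : MeasurableEmbedding ((↑) : Disc → ℂ) :=
    MeasurableEmbedding.subtype_coe Metric.isOpen_ball.measurableSet
  refine ⟨K⁻¹ * (c'⁻¹ ^ ((2 : ℝ≥0∞).toReal⁻¹) *
    (volume (Metric.ball (0 : ℂ) 1)) ^ (1 / (1 : ℝ≥0∞).toReal - 1 / (2 : ℝ≥0∞).toReal)), ?_, ?_⟩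
  · refine ENNReal.mul_ne_top (ENNReal.inv_ne_top.mpr hK0) (ENNReal.mul_ne_top ?_ ?_)
    · exact ENNReal.rpow_ne_top_of_nonneg (by positivity) (ENNReal.inv_ne_top.mpr hc0)
    · exact ENNReal.rpow_ne_top_of_nonneg (by norm_num) measure_ball_lt_top.ne
  intro f hf z hz
  obtain ⟨F, hF, hfF⟩ := id hf
  set S : Set Disc := (↑) ⁻¹' Metric.ball (z : ℂ) δ with hS
  have hSm : MeasurableSet S :=
    measurable_subtype_coe Metric.isOpen_ball.measurableSet
  have hsub : Metric.ball (z : ℂ) δ ⊆ Metric.ball 0 1 := by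
    intro w hw
    rw [mem_ball_iff_norm] at hw
    rw [mem_ball_zero_iff]
    calc ‖w‖ = ‖(z : ℂ) + (w - z)‖ := by congr 1; ring
      _ ≤ ‖(z : ℂ)‖ + ‖w - z‖ := norm_add_le _ _
      _ < 1 := by rw [hδ_def] at hw; linarith
  have himg : (↑) '' S = Metric.ball (z : ℂ) δ := by
    rw [hS, Subtype.image_preimage_coe, Set.inter_eq_right]
    exact hsub
  have hmap : (ν.restrict S).map ((↑) : Disc → ℂ) = volume.restrict (Metric.ball (z : ℂ) δ) := by
    rw [hS, ← Measure.restrict_map measurable_subtype_coe Metric.isOpen_ball.measurableSet, hν,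
      map_comap_subtype_coe Metric.isOpen_ball.measurableSet,
      Measure.restrict_restrict Metric.isOpen_ball.measurableSet, Set.inter_eq_left.mpr hsub]
  have h1 : K * ‖f z‖ₑ ≤ eLpNorm f 1 (ν.restrict S) := by
    rw [eLpNorm_one_eq_lintegral_enorm, hfF z]
    refine (area_mean_le hF hδ (by rw [hδ_def]; linarith)).trans_eq ?_
    rw [← hmap, hemb.lintegral_map]
    simp only [hfF]
  have h2 : ν.restrict S ≤ c'⁻¹ • discMeasure α := by
    have h3 : c' • ν.restrict S ≤ discMeasure α := by
      rw [← withDensity_const]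
      calc (ν.restrict S).withDensity (fun _ => c')
          ≤ (ν.restrict S).withDensity
            (fun z => ENNReal.ofReal ((α + 1) / Real.pi * (1 - ‖(z : ℂ)‖ ^ 2) ^ α)) := by
            refine withDensity_mono ((ae_restrict_mem hSm).mono fun w hw => ?_)
            refine ENNReal.ofReal_le_ofReal (hcw w ?_)
            rw [hS, Set.mem_preimage, mem_ball_iff_norm] at hw
            calc ‖(w : ℂ)‖ = ‖(z : ℂ) + (w - z)‖ := by congr 1; ring
              _ ≤ ‖(z : ℂ)‖ + ‖(w : ℂ) - z‖ := norm_add_le _ _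
              _ ≤ r + δ := by linarith
        _ = (discMeasure α).restrict S := by
            rw [discMeasure, restrict_withDensity hSm]
        _ ≤ discMeasure α := Measure.restrict_le_self
    calc ν.restrict S = c'⁻¹ • c' • ν.restrict S := by
          rw [smul_smul, ENNReal.inv_mul_cancel hc0 hct, one_smul]
      _ ≤ _ := by gcongr
  have h4 : eLpNorm f 1 (ν.restrict S) ≤ eLpNorm f 2 (ν.restrict S) *
      (volume (Metric.ball (0 : ℂ) 1)) ^ (1 / (1 : ℝ≥0∞).toReal - 1 / (2 : ℝ≥0∞).toReal) := by
    refine (eLpNorm_le_eLpNorm_mul_rpow_measure_univ one_le_two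
      (hf.aestronglyMeasurable _)).trans ?_
    gcongr
    · norm_num
    · rw [Measure.restrict_apply_univ, hν, comap_subtype_coe_apply
        Metric.isOpen_ball.measurableSet, himg]
      exact measure_mono hsub
  have h5 : eLpNorm f 2 (ν.restrict S) ≤
      c'⁻¹ ^ ((2 : ℝ≥0∞).toReal⁻¹) * eLpNorm f 2 (discMeasure α) := by
    refine (eLpNorm_mono_measure f h2).trans_eq ?_
    rw [eLpNorm_smul_measure_of_ne_top (by norm_num)]
    simp
  calc ‖f z‖ₑ = K⁻¹ * (K * ‖f z‖ₑ) := by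
        rw [← mul_assoc, ENNReal.inv_mul_cancel hK0 hKt, one_mul]
    _ ≤ K⁻¹ * (c'⁻¹ ^ ((2 : ℝ≥0∞).toReal⁻¹) * eLpNorm f 2 (discMeasure α) *
        (volume (Metric.ball (0 : ℂ) 1)) ^ (1 / (1 : ℝ≥0∞).toReal - 1 / (2 : ℝ≥0∞).toReal)) := by
        exact mul_le_mul_right (h1.trans (h4.trans (mul_le_mul_left h5 _))) _
    _ = _ := by ring

end PointEvaluation

section Space

variable (α : ℝ) (H : Type*) [NormedAddCommGroup H] [InnerProductSpace ℂ H]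

/-- The linear space of analytic `f : 𝔻 → H` with `∫ ‖f‖² dA_α < ∞`. -/
def bergmanSubmodule : Submodule ℂ (Disc → H) where
  carrier := {f | DiscAnalytic f ∧ MemLp f 2 (discMeasure α)}
  zero_mem' := ⟨⟨0, analyticOnNhd_const, fun _ => rfl⟩, MemLp.zero⟩
  add_mem' := by
    rintro f g ⟨⟨F, hF, hfF⟩, hf⟩ ⟨⟨G, hG, hgG⟩, hg⟩
    exact ⟨⟨F + G, hF.add hG, fun z => by simp [hfF, hgG]⟩, hf.add hg⟩
  smul_mem' := by
    rintro c f ⟨⟨F, hF, hfF⟩, hf⟩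
    exact ⟨⟨c • F, analyticOnNhd_const.smul hF, fun z => by simp [hfF]⟩, hf.const_smul c⟩

/-- The vector-valued weighted Bergman space `A²_α(H)`: the analytic functions `f : 𝔻 → H` with
`∫ ‖f‖² dA_α < ∞`. It is a type of its own (not a reducible subtype of `𝔻 → H`), so that its only
topology is the one of the norm below. -/
def Bergman : Type _ := bergmanSubmodule α H

instance : AddCommGroup (Bergman α H) := inferInstanceAs (AddCommGroup (bergmanSubmodule α H))

instance : Module ℂ (Bergman α H) := inferInstanceAs (Module ℂ (bergmanSubmodule α H))

instance : CoeFun (Bergman α H) (fun _ => Disc → H) := ⟨fun f => f.1⟩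

variable {α H}

theorem Bergman.ext {f g : Bergman α H} (h : ∀ z, f z = g z) : f = g :=
  Subtype.ext (funext h)

theorem Bergman.add_apply (f g : Bergman α H) (z : Disc) : (f + g) z = f z + g z := rfl

theorem Bergman.smul_apply (c : ℂ) (f : Bergman α H) (z : Disc) : (c • f) z = c • f z := rfl

theorem Bergman.analytic (f : Bergman α H) : DiscAnalytic f := f.2.1

theorem Bergman.memLp (f : Bergman α H) : MemLp f 2 (discMeasure α) := f.2.2

theorem Bergman.integral_inner_eq (f g : Bergman α H) :
    ∫ z, inner ℂ (f z) (g z) ∂(discMeasure α) = inner ℂ (f.memLp.toLp f) (g.memLp.toLp g) := by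
  rw [L2.inner_def]
  refine integral_congr_ae ?_
  filter_upwards [f.memLp.coeFn_toLp, g.memLp.coeFn_toLp] with z h1 h2
  rw [h1, h2]

theorem Bergman.eq_zero_of_eLpNorm [CompleteSpace H] (hα : -1 < α) (f : Bergman α H)
    (hf : eLpNorm f 2 (discMeasure α) = 0) : f = 0 := by
  refine Bergman.ext fun z => ?_
  obtain ⟨C, -, h⟩ := exists_point_bound (H := H) hα (r := ‖(z : ℂ)‖)
    (mem_ball_zero_iff.mp z.2)
  have := h f f.analytic z le_rfl
  rw [hf, mul_zero, nonpos_iff_eq_zero, enorm_eq_zero] at this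
  exact this

variable (α H)

/-- The inner product `⟨f, g⟩ = ∫ ⟨f(z), g(z)⟩ dA_α(z)` of `A²_α(H)` (conjugate linear in the first
variable, as usual in Mathlib). -/
@[reducible]
def Bergman.core [hα : Fact (-1 < α)] [CompleteSpace H] :
    InnerProductSpace.Core ℂ (Bergman α H) where
  inner f g := ∫ z, inner ℂ (f z) (g z) ∂(discMeasure α)
  conj_inner_symm f g := by
    simp only [Bergman.integral_inner_eq]
    exact inner_conj_symm _ _
  re_inner_nonneg f := by
    simp only [Bergman.integral_inner_eq]
    exact inner_self_nonneg
  add_left f g h := by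
    simp only [Bergman.integral_inner_eq]
    rw [← inner_add_left]
    rfl
  smul_left f g c := by
    simp only [Bergman.integral_inner_eq]
    rw [← inner_smul_left]
    rfl
  definite f hf := by
    rw [Bergman.integral_inner_eq, inner_self_eq_zero] at hf
    refine Bergman.eq_zero_of_eLpNorm hα.out f ?_
    have h := Lp.norm_toLp f f.memLp
    rw [hf, norm_zero] at h
    exact ((ENNReal.toReal_eq_zero_iff _).mp h.symm).resolve_right f.memLp.eLpNorm_ne_top

instance [Fact (-1 < α)] [CompleteSpace H] : NormedAddCommGroup (Bergman α H) :=
  (Bergman.core α H).toNormedAddCommGroup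

instance [Fact (-1 < α)] [CompleteSpace H] : InnerProductSpace ℂ (Bergman α H) :=
  InnerProductSpace.ofCore (Bergman.core α H).toCore

variable {α H}

theorem Bergman.inner_def [Fact (-1 < α)] [CompleteSpace H] (f g : Bergman α H) :
    inner ℂ f g = ∫ z, inner ℂ (f z) (g z) ∂(discMeasure α) := rfl

theorem Bergman.norm_eq [Fact (-1 < α)] [CompleteSpace H] (f : Bergman α H) :
    ‖f‖ = (eLpNorm f 2 (discMeasure α)).toReal := by
  rw [← Lp.norm_toLp f f.memLp, norm_eq_sqrt_re_inner (𝕜 := ℂ) f, Bergman.inner_def,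
    Bergman.integral_inner_eq, ← norm_eq_sqrt_re_inner]

theorem Bergman.enorm_eq [Fact (-1 < α)] [CompleteSpace H] (f : Bergman α H) :
    ‖f‖ₑ = eLpNorm f 2 (discMeasure α) := by
  rw [← ofReal_norm, Bergman.norm_eq, ENNReal.ofReal_toReal f.memLp.eLpNorm_ne_top]

/-- `A²_α(H)` is complete, i.e. it is a Hilbert space. -/
instance [hα : Fact (-1 < α)] [CompleteSpace H] : CompleteSpace (Bergman α H) := by
  refine Metric.complete_of_cauchySeq_tendsto fun u hu => ?_
  -- limit in `L²`
  set v : ℕ → Lp H 2 (discMeasure α) := fun n => (u n).memLp.toLp (u n) with hv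
  have hvdist : ∀ m n, dist (v m) (v n) = dist (u m) (u n) := by
    intro m n
    rw [dist_eq_norm, dist_eq_norm, hv, ← MemLp.toLp_sub, Lp.norm_toLp, Bergman.norm_eq]
    rfl
  have hvc : CauchySeq v := by
    rw [Metric.cauchySeq_iff] at hu ⊢
    simpa only [hvdist] using hu
  obtain ⟨g, hg⟩ := cauchySeq_tendsto_of_complete hvc
  -- locally uniform limit
  choose F hF hfF using fun n => (u n).analytic
  have hunif : ∀ r < 1, UniformCauchySeqOn F atTop (Metric.closedBall 0 r) := by
    intro r hr
    obtain ⟨C, hC, hb⟩ := exists_point_bound (H := H) hα.out hr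
    rw [Metric.uniformCauchySeqOn_iff]
    intro ε hε
    obtain ⟨N, hN⟩ := Metric.cauchySeq_iff.mp hu (ε / (C.toReal + 1)) (by positivity)
    refine ⟨N, fun m hm n hn x hx => ?_⟩
    rw [mem_closedBall_zero_iff] at hx
    have hx1 : x ∈ Metric.ball (0 : ℂ) 1 := by rw [mem_ball_zero_iff]; linarith
    have h1 := hb (u m - u n : Bergman α H) (u m - u n).analytic ⟨x, hx1⟩ hx
    rw [← Bergman.enorm_eq] at h1
    have h2 : (u m - u n : Bergman α H) ⟨x, hx1⟩ = F m x - F n x := by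
      rw [← hfF m ⟨x, hx1⟩, ← hfF n ⟨x, hx1⟩]; rfl
    rw [h2] at h1
    have h3 : ‖F m x - F n x‖ ≤ C.toReal * ‖u m - u n‖ := by
      have := ENNReal.toReal_mono (ENNReal.mul_ne_top hC enorm_ne_top) h1
      simpa [ENNReal.toReal_mul] using this
    have h4 := hN m hm n hn
    rw [dist_eq_norm] at h4 ⊢
    have hC0 : 0 ≤ C.toReal := ENNReal.toReal_nonneg
    rw [lt_div_iff₀ (by positivity)] at h4
    nlinarith [norm_nonneg (u m - u n)]
  have hlim : ∀ x ∈ Metric.ball (0 : ℂ) 1, ∃ y, Tendsto (fun n => F n x) atTop (𝓝 y) := by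
    intro x hx
    refine cauchySeq_tendsto_of_complete ((hunif ‖x‖ (by simpa using hx)).cauchySeq ?_)
    simp
  choose! G hG using hlim
  have hGan : AnalyticOnNhd ℂ G (Metric.ball 0 1) := by
    refine DifferentiableOn.analyticOnNhd ?_ Metric.isOpen_ball
    have hloc : TendstoLocallyUniformlyOn F G atTop (Metric.ball 0 1) := by
      rw [tendstoLocallyUniformlyOn_iff_forall_isCompact Metric.isOpen_ball]
      intro K hK hKc
      obtain ⟨r, hr, hKr⟩ : ∃ r < 1, K ⊆ Metric.closedBall (0 : ℂ) r := by
        rcases K.eq_empty_or_nonempty with rfl | hne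
        · exact ⟨0, one_pos, Set.empty_subset _⟩
        · obtain ⟨x, hx, hmax⟩ := hKc.exists_isMaxOn hne continuous_norm.continuousOn
          exact ⟨‖x‖, by simpa using hK hx, fun y hy => by simpa using hmax hy⟩
      refine ((hunif r hr).mono hKr).tendstoUniformlyOn_of_tendsto fun x hx => hG x (hK hx)
    exact hloc.differentiableOn (Eventually.of_forall fun n => (hF n).differentiableOn)
      Metric.isOpen_ball
  -- the two limits agree
  have hae : (fun z : Disc => G z) =ᵐ[discMeasure α] g := by
    obtain ⟨ns, hns, hlim'⟩ := (tendstoInMeasure_of_tendsto_Lp hg).exists_seq_tendsto_ae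
    have hall : ∀ᵐ z ∂(discMeasure α), ∀ n, v n z = u n z :=
      ae_all_iff.mpr fun n => (u n).memLp.coeFn_toLp
    filter_upwards [hlim', hall] with z h1 h2
    refine tendsto_nhds_unique ((hG z z.2).comp hns.tendsto_atTop) ?_
    refine h1.congr fun n => ?_
    rw [h2, hfF]
    rfl
  have hmem : MemLp (fun z : Disc => G z) 2 (discMeasure α) := (memLp_congr_ae hae).mpr (Lp.memLp g)
  let f : Bergman α H := ⟨fun z : Disc => G z, ⟨G, hGan, fun _ => rfl⟩, hmem⟩
  refine ⟨f, ?_⟩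
  have hfg : f.memLp.toLp f = g := by
    refine Lp.ext (f.memLp.coeFn_toLp.trans hae)
  rw [tendsto_iff_dist_tendsto_zero] at hg ⊢
  refine hg.congr fun n => ?_
  rw [← hfg, dist_eq_norm, dist_eq_norm, hv, ← MemLp.toLp_sub, Lp.norm_toLp, Bergman.norm_eq]
  rfl

/-- `T` is the composition operator `C_Φ` on `A²_α(H)`: the bounded operator `f ↦ f ∘ Φ`. (For a
given `Φ` there is at most one such `T`.) -/
def IsCompositionOperator [Fact (-1 < α)] [CompleteSpace H] (Φ : Disc → Disc)
    (T : Bergman α H →L[ℂ] Bergman α H) : Prop :=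
  ∀ (f : Bergman α H) (z : Disc), T f z = f (Φ z)

theorem IsCompositionOperator.unique [Fact (-1 < α)] [CompleteSpace H] {Φ : Disc → Disc}
    {S T : Bergman α H →L[ℂ] Bergman α H} (hS : IsCompositionOperator Φ S)
    (hT : IsCompositionOperator Φ T) : S = T :=
  ContinuousLinearMap.ext fun f => Bergman.ext fun z => (hS f z).trans (hT f z).symm

end Space

/-- A bounded operator `T` on a Hilbert space is a co-isometry if `T T* = I`. -/
def IsCoisometry {Y : Type*} [NormedAddCommGroup Y] [InnerProductSpace ℂ Y] [CompleteSpace Y]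
    (T : Y →L[ℂ] Y) : Prop :=
  T ∘L ContinuousLinearMap.adjoint T = ContinuousLinearMap.id ℂ Y

end VVBergman

end

/-! The pairings with two families of functions decide everything. Write `1_h` for the constant
function `h` and `ℓ_h` for `z ↦ z • h`. Since `dA_α` is invariant under rotations, the mean value
property gives `⟨1_h, f⟩ = m₀ ⟨h, f(0)⟩` and `⟨ℓ_h, f⟩ = m₁ ⟨h, f'(0)⟩`, where `m₀ = ∫ 1 dA_α` and
`m₁ = ∫ |z|² dA_α` (`Bergman.inner_const`, `Bergman.inner_linear`).

Let `T = C_Φ` satisfy `T T* = I` and take `h ≠ 0`. As `T 1_h = 1_h`, also `T* 1_h = 1_h`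
(`IsCoisometry.adjoint_apply_eq_self`), so `⟨1_h, T f⟩ = ⟨1_h, f⟩` for every `f`; the choice `f =
ℓ_h` forces `Φ(0) = 0`. The chain rule at the origin then makes `ℓ_h` an eigenvector of `T*` with
eigenvalue `a`, the conjugate of `Φ'(0)` (`IsCompositionOperator.adjoint_linear`). Because `T*` is
isometric, `|a| = 1`; and `ℓ_h = T T* ℓ_h = a • (ℓ_h ∘ Φ)` says `z = a Φ(z)`. The Schwarz lemma is
not needed.

Conversely, a rotation preserves `dA_α`, so composition with it is unitary, with composition by the
inverse rotation as inverse and adjoint. -/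

noncomputable section

namespace VVBergman

/-! ### Rotation invariance of the weighted area measure. -/

section Rotation

/-- The rotation of the disc by a unimodular number. -/
def Disc.rotate (u : Circle) (z : Disc) : Disc :=
  ⟨u * z, by
    have := mem_ball_zero_iff.mp z.2
    rw [mem_ball_zero_iff, norm_mul, Circle.norm_coe, one_mul]
    exact this⟩

@[simp]
theorem Disc.coe_rotate (u : Circle) (z : Disc) : (Disc.rotate u z : ℂ) = u * z := rfl

theorem Disc.norm_lt_one (z : Disc) : ‖(z : ℂ)‖ < 1 := mem_ball_zero_iff.mp z.2

/-- Joint continuity supplies the measurability that Fubini needs when averaging over the angle. -/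
theorem Disc.continuous_uncurry_rotate : Continuous fun p : Circle × Disc => Disc.rotate p.1 p.2 :=
  Continuous.subtype_mk (by fun_prop) _

theorem Disc.continuous_rotate (u : Circle) : Continuous (Disc.rotate u) :=
  Disc.continuous_uncurry_rotate.comp (Continuous.prodMk_right u)

theorem Disc.measurePreserving_rotate_comap (u : Circle) :
    MeasurePreserving (Disc.rotate u) (Measure.comap ((↑) : Disc → ℂ) volume)
      (Measure.comap ((↑) : Disc → ℂ) volume) := by
  have hm := (Disc.continuous_rotate u).measurable
  refine ⟨hm, Measure.ext fun s hs => ?_⟩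
  -- The disc is stable under rotations, so the claim reduces to Lebesgue measure on the plane,
  -- which the linear isometry `rotation u` preserves.
  have hset : ((↑) : Disc → ℂ) '' (Disc.rotate u ⁻¹' s) = rotation u ⁻¹' ((↑) '' s) := by
    ext w
    constructor
    · rintro ⟨z, hz, rfl⟩
      exact ⟨Disc.rotate u z, hz, rfl⟩
    · rintro ⟨z, hz, hzw⟩
      rw [rotation_apply] at hzw
      have hw : w ∈ Metric.ball (0 : ℂ) 1 := by
        have := z.norm_lt_one
        rwa [hzw, norm_mul, Circle.norm_coe, one_mul, ← mem_ball_zero_iff] at this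
      refine ⟨⟨w, hw⟩, ?_, rfl⟩
      rw [Set.mem_preimage]
      rwa [show Disc.rotate u ⟨w, hw⟩ = z from Subtype.ext hzw.symm]
  have himg : MeasurableSet (((↑) : Disc → ℂ) '' s) :=
    Metric.isOpen_ball.measurableSet.subtype_image hs
  rw [Measure.map_apply hm hs, comap_subtype_coe_apply Metric.isOpen_ball.measurableSet,
    comap_subtype_coe_apply Metric.isOpen_ball.measurableSet, hset,
    (rotation u).measurePreserving.measure_preimage himg.nullMeasurableSet]

/-- The weighted area measure is invariant under rotations. -/
theorem measurePreserving_rotate (α : ℝ) (u : Circle) :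
    MeasurePreserving (Disc.rotate u) (discMeasure α) (discMeasure α) := by
  have hν := Disc.measurePreserving_rotate_comap u
  refine ⟨hν.measurable, Measure.ext fun s hs => ?_⟩
  rw [Measure.map_apply hν.measurable hs, discMeasure, withDensity_apply _ hs,
    withDensity_apply _ (hν.measurable hs)]
  -- After this change of variables only the density is left to compare, and it depends on `‖z‖`
  -- alone.
  rw [← hν.setLIntegral_comp_preimage hs (by fun_prop)]
  simp only [Disc.coe_rotate, norm_mul, Circle.norm_coe, one_mul]

end Rotation

/-! ### Finiteness of the weighted area measure. -/

section Finite

/-- For `α < 0` the weight blows up at `r = 1`, but its antiderivative `-(1 - r²)^(α+1) / (2(α+1))`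
stays continuous on `[0, 1]` because `α + 1 > 0`. A nonnegative derivative of such a function is
integrable. -/
theorem integrableOn_radial_weight {α : ℝ} (hα : -1 < α) :
    IntegrableOn (fun r : ℝ => r * (1 - r ^ 2) ^ α) (Set.Ioo 0 1) := by
  have hα' : 0 < α + 1 := by linarith
  have h := intervalIntegral.integrableOn_deriv_of_nonneg (a := 0) (b := 1)
    (g := fun r : ℝ => -(1 - r ^ 2) ^ (α + 1) / (2 * (α + 1)))
    (g' := fun r : ℝ => r * (1 - r ^ 2) ^ α) ?_ ?_ ?_
  · exact h.mono_set Set.Ioo_subset_Ioc_self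
  · refine ContinuousOn.div_const (ContinuousOn.neg ?_) _
    exact ContinuousOn.rpow_const (by fun_prop) fun x _ => Or.inr hα'.le
  · intro x hx
    have hx1 : 0 < 1 - x ^ 2 := by nlinarith [hx.1, hx.2]
    have h1 : HasDerivAt (fun r : ℝ => 1 - r ^ 2) (-(2 * x)) x := by
      simpa using ((hasDerivAt_id x).pow 2).const_sub 1
    have h2 := ((h1.rpow_const (p := α + 1) (Or.inl hx1.ne')).neg).div_const (2 * (α + 1))
    refine h2.congr_deriv ?_
    rw [add_sub_cancel_right]
    field_simp
  · intro x hx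
    have hx1 : 0 < 1 - x ^ 2 := by nlinarith [hx.1, hx.2]
    have := hx.1
    positivity

theorem isFiniteMeasure_discMeasure {α : ℝ} (hα : -1 < α) : IsFiniteMeasure (discMeasure α) := by
  refine ⟨?_⟩
  have hemb : MeasurableEmbedding ((↑) : Disc → ℂ) :=
    MeasurableEmbedding.subtype_coe Metric.isOpen_ball.measurableSet
  set w : ℝ → ℝ≥0∞ := fun r => ENNReal.ofReal ((α + 1) / Real.pi * (1 - r ^ 2) ^ α) with hw
  have hwm : Measurable w := by fun_prop
  have h1 : discMeasure α Set.univ = ∫⁻ z, (Metric.ball (0 : ℂ) 1).indicator (fun z => w ‖z‖) z := by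
    rw [discMeasure, withDensity_apply _ MeasurableSet.univ, Measure.restrict_univ,
      lintegral_indicator Metric.isOpen_ball.measurableSet,
      ← map_comap_subtype_coe Metric.isOpen_ball.measurableSet, hemb.lintegral_map]
  rw [h1, ← Complex.lintegral_comp_polarCoord_symm]
  -- An upper bound suffices; in polar coordinates the integrand vanishes for `r ≥ 1`.
  calc _ ≤ ∫⁻ p in Set.Ioo (0 : ℝ) 1 ×ˢ Set.Ioo (-Real.pi) Real.pi,
          ENNReal.ofReal p.1 * w p.1 := by
        rw [← lintegral_indicator polarCoord.open_target.measurableSet,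
          ← lintegral_indicator (measurableSet_Ioo.prod measurableSet_Ioo)]
        refine lintegral_mono fun p => ?_
        refine Set.indicator_le (fun p hp => ?_) p
        rw [polarCoord_target] at hp
        have hp1 : 0 < p.1 := hp.1
        by_cases h : p.1 < 1
        · rw [Set.indicator_of_mem (show p ∈ Set.Ioo (0 : ℝ) 1 ×ˢ Set.Ioo (-Real.pi) Real.pi from
            ⟨⟨hp1, h⟩, hp.2⟩), smul_eq_mul]
          gcongr
          refine (Set.indicator_le_self _ _ _).trans_eq ?_
          rw [Complex.norm_polarCoord_symm, abs_of_pos hp1]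
        · rw [Set.indicator_of_notMem (s := Metric.ball (0 : ℂ) 1), smul_zero]
          · exact zero_le
          · rwa [mem_ball_zero_iff, Complex.norm_polarCoord_symm, abs_of_pos hp1]
    _ = ∫⁻ r in Set.Ioo (0 : ℝ) 1, ∫⁻ _ in Set.Ioo (-Real.pi) Real.pi,
          ENNReal.ofReal r * w r := by
        rw [Measure.volume_eq_prod, setLIntegral_prod]
        exact Measurable.aemeasurable (by fun_prop)
    _ = (∫⁻ r in Set.Ioo (0 : ℝ) 1,
          ENNReal.ofReal ((α + 1) / Real.pi * (r * (1 - r ^ 2) ^ α))) *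
          volume (Set.Ioo (-Real.pi) Real.pi) := by
        simp only [setLIntegral_const]
        rw [lintegral_mul_const _ (by fun_prop)]
        congr 1
        refine setLIntegral_congr_fun measurableSet_Ioo fun r hr => ?_
        rw [hw, ← ENNReal.ofReal_mul hr.1.le]
        congr 1
        ring
    _ < ∞ := by
        refine ENNReal.mul_lt_top ?_ measure_Ioo_lt_top
        exact ((integrableOn_radial_weight hα).const_mul ((α + 1) / Real.pi)).lintegral_lt_top

end Finite

/-! ### Mean value formulas for the value and the derivative at the origin. -/

section MeanValue

variable {X : Type*} [NormedAddCommGroup X] [NormedSpace ℂ X]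

/-- The integral against a rotation invariant measure is the integral of the averages over
circles. -/
theorem integral_circle_average [CompleteSpace X] {α : ℝ} (hα : -1 < α) {g : Disc → X}
    (hg : Integrable g (discMeasure α)) :
    ∫ z, g z ∂(discMeasure α) = ∫ z, ((2 * Real.pi)⁻¹ •
      ∫ θ in (0 : ℝ)..2 * Real.pi, g (Disc.rotate (Circle.exp θ) z)) ∂(discMeasure α) := by
  have := isFiniteMeasure_discMeasure hα
  have hpi := Real.pi_pos
  set I : Measure ℝ := volume.restrict (Set.Ioc 0 (2 * Real.pi)) with hI
  -- The shear `(θ, z) ↦ (θ, e^{iθ} z)` preserves the product measure, so integrability of `g`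
  -- passes to `g (e^{iθ} z)` on the product and Fubini applies.
  have hmp : MeasurePreserving (fun p : ℝ × Disc => (id p.1, Disc.rotate (Circle.exp p.1) p.2))
      (I.prod (discMeasure α)) (I.prod (discMeasure α)) := by
    refine (MeasurePreserving.id I).skew_product (g := fun θ z => Disc.rotate (Circle.exp θ) z)
      ?_ (ae_of_all _ fun θ => (measurePreserving_rotate α _).map_eq)
    refine Continuous.measurable ?_
    exact Disc.continuous_uncurry_rotate.comp
      ((Circle.exp.continuous.comp continuous_fst).prodMk continuous_snd)
  have hint : Integrable (fun p : ℝ × Disc => g (Disc.rotate (Circle.exp p.1) p.2))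
      (I.prod (discMeasure α)) :=
    hmp.integrable_comp_of_integrable (hg.comp_snd I)
  have hmean : ∀ θ : ℝ, ∫ z, g (Disc.rotate (Circle.exp θ) z) ∂(discMeasure α) =
      ∫ z, g z ∂(discMeasure α) := fun θ => by
    have h := measurePreserving_rotate α (Circle.exp θ)
    conv_rhs => rw [← h.map_eq]
    rw [integral_map h.measurable.aemeasurable (by rw [h.map_eq]; exact hg.1)]
  simp only [intervalIntegral.integral_of_le (show (0 : ℝ) ≤ 2 * Real.pi by positivity)]
  rw [integral_smul, ← hI, ← integral_integral_swap (f := fun (θ : ℝ) z =>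
    g (Disc.rotate (Circle.exp θ) z)) hint]
  simp only [hmean, hI]
  rw [setIntegral_const, smul_smul, Measure.real, Real.volume_Ioc, sub_zero,
    ENNReal.toReal_ofReal (by positivity), inv_mul_cancel₀ (by positivity), one_smul]

/-- The mean value property, with a rotation invariant weight. -/
theorem integral_radial_smul [CompleteSpace X] {α : ℝ} (hα : -1 < α) {G : ℂ → X}
    (hG : AnalyticOnNhd ℂ G (Metric.ball 0 1)) {k : Disc → ℂ}
    (hk : ∀ u z, k (Disc.rotate u z) = k z)
    (hint : Integrable (fun z : Disc => k z • G z) (discMeasure α)) :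
    ∫ z : Disc, k z • G z ∂(discMeasure α) = (∫ z, k z ∂(discMeasure α)) • G 0 := by
  rw [integral_circle_average hα hint, ← integral_smul_const]
  refine integral_congr_ae (ae_of_all _ fun z => ?_)
  -- Since `|z| < 1`, the function `w ↦ G(w z)` is analytic up to the unit circle, and its mean
  -- there is `G 0`. The average over rotations of `z` is exactly this circle mean.
  have hmaps : Set.MapsTo (fun w : ℂ => w * z) (Metric.closedBall 0 1) (Metric.ball 0 1) := by
    intro w hw
    rw [mem_closedBall_zero_iff] at hw
    rw [mem_ball_zero_iff, norm_mul]
    nlinarith [z.norm_lt_one, norm_nonneg (z : ℂ)]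
  have hd : DiffContOnCl ℂ (fun w : ℂ => G (w * z)) (Metric.ball 0 |(1 : ℝ)|) := by
    rw [abs_one]
    refine DifferentiableOn.diffContOnCl ?_
    exact (hG.differentiableOn.comp (by fun_prop) hmaps).mono Metric.closure_ball_subset_closedBall
  have h := hd.circleAverage
  rw [Real.circleAverage_def] at h
  simp only [zero_mul] at h
  simp only [hk, Disc.coe_rotate, Circle.coe_exp]
  rw [intervalIntegral.integral_smul, smul_comm, ← h]
  simp [circleMap]

/-- `∫ conj z • G(z) dA_α(z)` picks out the derivative at the origin. -/
theorem integral_conj_smul [CompleteSpace X] {α : ℝ} (hα : -1 < α) {G : ℂ → X}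
    (hG : AnalyticOnNhd ℂ G (Metric.ball 0 1))
    (hint : Integrable (fun z : Disc => G z) (discMeasure α)) :
    ∫ z : Disc, (starRingEnd ℂ (z : ℂ)) • G z ∂(discMeasure α) =
      (∫ z : Disc, ((‖(z : ℂ)‖ : ℂ) ^ 2) ∂(discMeasure α)) • deriv G 0 := by
  have := isFiniteMeasure_discMeasure hα
  have hb : ∀ {Y : Type _} [NormedAddCommGroup Y] [NormedSpace ℂ Y] {g : Disc → Y},
      Integrable g (discMeasure α) →
      Integrable (fun z : Disc => (starRingEnd ℂ (z : ℂ)) • g z) (discMeasure α) := by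
    intro Y _ _ g hg
    refine hg.bdd_smul 1 (Continuous.aestronglyMeasurable (by fun_prop)) (ae_of_all _ fun z => ?_)
    rw [RCLike.norm_conj]
    exact z.norm_lt_one.le
  have hD : AnalyticOnNhd ℂ (dslope G 0) (Metric.ball 0 1) := by
    refine DifferentiableOn.analyticOnNhd ?_ Metric.isOpen_ball
    exact (Complex.differentiableOn_dslope
      (Metric.isOpen_ball.mem_nhds (Metric.mem_ball_self one_pos))).mpr hG.differentiableOn
  -- With `G(z) - G(0) = z • dslope G 0 z` and `conj z * z = |z|²`, the weight `conj z` becomes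
  -- radial in front of the analytic function `dslope G 0`, whose value at `0` is `G'(0)`.
  have hsplit : ∀ z : Disc, ((‖(z : ℂ)‖ : ℂ) ^ 2) • dslope G 0 z =
      (starRingEnd ℂ (z : ℂ)) • G z - (starRingEnd ℂ (z : ℂ)) • G 0 := by
    intro z
    have h := sub_smul_dslope G 0 (z : ℂ)
    rw [sub_zero] at h
    rw [← smul_sub, ← h, smul_smul, Complex.conj_mul']
  have h1 := hb hint
  have h2 := hb (integrable_const (μ := discMeasure α) (G 0))
  have hrad := integral_radial_smul hα hD (k := fun z => (‖(z : ℂ)‖ : ℂ) ^ 2)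
    (fun u z => by simp only [Disc.coe_rotate, norm_mul, Circle.norm_coe, one_mul])
    ((h1.sub h2).congr (ae_of_all _ fun z => (hsplit z).symm))
  -- The contribution of the constant `G 0` drops out, by the mean value property of the identity
  -- function.
  have hzero : ∫ z : Disc, (starRingEnd ℂ (z : ℂ)) ∂(discMeasure α) = 0 := by
    rw [integral_conj]
    have hid : Integrable (fun z : Disc => (1 : ℂ) • (id (z : ℂ))) (discMeasure α) := by
      simp only [one_smul]
      refine Integrable.of_bound (Continuous.aestronglyMeasurable (by fun_prop)) 1
        (ae_of_all _ fun z => z.norm_lt_one.le)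
    have := integral_radial_smul hα (G := id) analyticOnNhd_id (k := fun _ => 1)
      (fun _ _ => rfl) hid
    simp only [one_smul, id, smul_zero] at this
    rw [this, map_zero]
  rw [← dslope_same, ← hrad]
  simp only [hsplit]
  rw [integral_sub h1 h2, integral_smul_const, hzero, zero_smul, sub_zero]

end MeanValue

end VVBergman

end

noncomputable section

namespace VVBergman

/-! ### Constant and linear functions as representatives of `f(0)` and `f'(0)`. -/

section Space

variable {α : ℝ} [hα : Fact (-1 < α)] {H : Type*} [NormedAddCommGroup H] [InnerProductSpace ℂ H]

theorem Bergman.integrable (f : Bergman α H) : Integrable f (discMeasure α) := by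
  have := isFiniteMeasure_discMeasure hα.out
  exact f.memLp.integrable one_le_two

variable (α) in
/-- The bounded analytic function `z ↦ F z • h` as an element of the Bergman space. -/
def Bergman.ofBounded (F : ℂ → ℂ) (hF : AnalyticOnNhd ℂ F (Metric.ball 0 1))
    (hb : ∀ z : Disc, ‖F z‖ ≤ 1) (h : H) : Bergman α H :=
  ⟨fun z => F z • h, ⟨fun z => F z • h, hF.smul analyticOnNhd_const, fun _ => rfl⟩, by
    have := isFiniteMeasure_discMeasure hα.out
    have hd : DiscAnalytic fun z : Disc => F z • h :=
      ⟨fun z => F z • h, hF.smul analyticOnNhd_const, fun _ => rfl⟩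
    refine MemLp.of_bound (hd.aestronglyMeasurable _) ‖h‖ (ae_of_all _ fun z => ?_)
    rw [norm_smul]
    exact mul_le_of_le_one_left (norm_nonneg h) (hb z)⟩

theorem Bergman.ofBounded_apply {F : ℂ → ℂ} {hF : AnalyticOnNhd ℂ F (Metric.ball 0 1)}
    {hb : ∀ z : Disc, ‖F z‖ ≤ 1} {h : H} (z : Disc) :
    Bergman.ofBounded α F hF hb h z = F z • h := rfl

variable (α) in
/-- The constant function with value `h`. -/
def Bergman.const (h : H) : Bergman α H :=
  Bergman.ofBounded α (fun _ => 1) analyticOnNhd_const (fun _ => by simp) h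

variable (α) in
/-- The function `z ↦ z • h`. -/
def Bergman.linear (h : H) : Bergman α H :=
  Bergman.ofBounded α id analyticOnNhd_id (fun z => z.norm_lt_one.le) h

theorem Bergman.const_apply (h : H) (z : Disc) : Bergman.const α h z = h :=
  one_smul ℂ h

theorem Bergman.linear_apply (h : H) (z : Disc) : Bergman.linear α h z = (z : ℂ) • h := rfl

variable [CompleteSpace H]

/-- The mean value property with constant weight, paired with `h`: up to the total mass, constants
reproduce the value at the origin. -/
theorem Bergman.inner_const (h : H) {f : Bergman α H} {F : ℂ → H}
    (hF : AnalyticOnNhd ℂ F (Metric.ball 0 1)) (hfF : ∀ z : Disc, f z = F z) :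
    inner ℂ (Bergman.const α h) f =
      (∫ _ : Disc, (1 : ℂ) ∂(discMeasure α)) * inner ℂ h (F 0) := by
  have hint : Integrable (fun z : Disc => (1 : ℂ) • F z) (discMeasure α) := by
    simpa only [one_smul, ← hfF] using f.integrable
  have h1 := integral_radial_smul hα.out hF (k := fun _ => 1) (fun _ _ => rfl) hint
  simp only [one_smul, ← hfF] at h1
  rw [Bergman.inner_def]
  simp only [Bergman.const_apply]
  rw [integral_inner f.integrable, h1, inner_smul_right]

/-- The inner product conjugates its first argument, so `z • h` contributes the factor `conj z` that
picks out the derivative at the origin in `integral_conj_smul`. -/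
theorem Bergman.inner_linear (h : H) {f : Bergman α H} {F : ℂ → H}
    (hF : AnalyticOnNhd ℂ F (Metric.ball 0 1)) (hfF : ∀ z : Disc, f z = F z) :
    inner ℂ (Bergman.linear α h) f =
      (∫ z : Disc, ((‖(z : ℂ)‖ : ℂ) ^ 2) ∂(discMeasure α)) * inner ℂ h (deriv F 0) := by
  have hint : Integrable (fun z : Disc => F z) (discMeasure α) := by
    simpa only [← hfF] using f.integrable
  have h1 := integral_conj_smul hα.out hF hint
  rw [Bergman.inner_def, ← inner_smul_right, ← h1, ← integral_inner]
  · simp only [Bergman.linear_apply, inner_smul_left, inner_smul_right, hfF]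
  · refine hint.bdd_smul 1 (Continuous.aestronglyMeasurable (by fun_prop)) (ae_of_all _ fun z => ?_)
    rw [RCLike.norm_conj]
    exact z.norm_lt_one.le

end Space

/-! ### Fixed vectors of co-isometries. -/

section Coisometry

variable {Y : Type*} [NormedAddCommGroup Y] [InnerProductSpace ℂ Y] [CompleteSpace Y]

/-- The adjoint of a co-isometry fixes every fixed vector of the co-isometry. -/
theorem IsCoisometry.adjoint_apply_eq_self {T : Y →L[ℂ] Y} (hT : IsCoisometry T) {x : Y}
    (hx : T x = x) : ContinuousLinearMap.adjoint T x = x := by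
  have hTT : T (ContinuousLinearMap.adjoint T x) = x := DFunLike.congr_fun hT x
  -- In the expansion of `‖T* x - x‖²` all four inner products equal `⟨x, x⟩`, so they cancel.
  rw [← sub_eq_zero, ← inner_self_eq_zero (𝕜 := ℂ), inner_sub_left, inner_sub_right,
    inner_sub_right, ContinuousLinearMap.adjoint_inner_left, ContinuousLinearMap.adjoint_inner_left,
    ContinuousLinearMap.adjoint_inner_right, hTT, hx]
  ring

end Coisometry

/-! ### Composition with rotations on the Bergman space. -/

section RotationMap

variable {α : ℝ} {H : Type*} [NormedAddCommGroup H] [InnerProductSpace ℂ H]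

variable (α H) in
/-- Composition with a rotation, as a linear map. -/
def rotationLinearMap (u : Circle) : Bergman α H →ₗ[ℂ] Bergman α H where
  toFun f := ⟨fun z => f (Disc.rotate u z), by
    obtain ⟨F, hF, hfF⟩ := f.analytic
    refine ⟨fun z => F (u * z), hF.comp (analyticOnNhd_const.mul analyticOnNhd_id) ?_,
      fun z => hfF _⟩
    exact fun z hz => (Disc.rotate u ⟨z, hz⟩).2,
    f.memLp.comp_measurePreserving (measurePreserving_rotate α u)⟩
  map_add' _ _ := rfl
  map_smul' _ _ := rfl

theorem rotationLinearMap_apply (u : Circle) (f : Bergman α H) (z : Disc) :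
    rotationLinearMap α H u f z = f (Disc.rotate u z) := rfl

theorem rotationLinearMap_comp_inv (u : Circle) (f : Bergman α H) :
    rotationLinearMap α H u (rotationLinearMap α H u⁻¹ f) = f :=
  Bergman.ext fun z => by
    rw [rotationLinearMap_apply, rotationLinearMap_apply]
    refine congrArg f.1 (Subtype.ext ?_)
    rw [Disc.coe_rotate, Disc.coe_rotate, ← mul_assoc, ← Circle.coe_mul, inv_mul_cancel,
      Circle.coe_one, one_mul]

end RotationMap

/-! ### Co-isometric composition operators and their symbols. -/

section Composition

variable {α : ℝ} [hα : Fact (-1 < α)] {H : Type*} [NormedAddCommGroup H] [InnerProductSpace ℂ H]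
  [CompleteSpace H] {Φ : Disc → Disc} {T : Bergman α H →L[ℂ] Bergman α H}

/-- The symbol of a co-isometric composition operator fixes the origin. -/
theorem IsCompositionOperator.map_zero_of_isCoisometry [Nontrivial H]
    (hT : IsCompositionOperator Φ T) (hco : IsCoisometry T) {P : ℂ → ℂ}
    (hP : AnalyticOnNhd ℂ P (Metric.ball 0 1)) (hΦP : ∀ z, (Φ z : ℂ) = P z) : P 0 = 0 := by
  obtain ⟨h, hh⟩ := exists_ne (0 : H)
  have hfix : T (Bergman.const α h) = Bergman.const α h := Bergman.ext fun z => by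
    rw [hT, Bergman.const_apply, Bergman.const_apply]
  have hadj := hco.adjoint_apply_eq_self hfix
  have h1 := ContinuousLinearMap.adjoint_inner_left T (Bergman.linear α h) (Bergman.const α h)
  have hc := Bergman.inner_const (α := α) h (f := Bergman.const α h) (F := fun _ => h)
    analyticOnNhd_const (fun z => Bergman.const_apply h z)
  -- By `hc` this number is the total mass times `⟨h, h⟩`; its nonvanishing follows from
  -- definiteness of the inner product, without computing the mass.
  have hc0 : inner ℂ (Bergman.const α h) (Bergman.const α h) ≠ 0 := by
    rw [Ne, inner_self_eq_zero]
    intro h0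
    have : Bergman.const α h ⟨0, Metric.mem_ball_self one_pos⟩ = 0 := by rw [h0]; rfl
    exact hh (by rwa [Bergman.const_apply] at this)
  rw [hadj, Bergman.inner_const h (F := fun z => z • h) (analyticOnNhd_id.smul analyticOnNhd_const)
    (fun z => rfl), Bergman.inner_const h (F := fun z => P z • h) (hP.smul analyticOnNhd_const)
    (fun z => by rw [hT, Bergman.linear_apply, hΦP]), zero_smul, inner_zero_right, mul_zero,
    inner_smul_right] at h1
  rw [hc] at hc0
  have h2 : P 0 * ((∫ _ : Disc, (1 : ℂ) ∂(discMeasure α)) * inner ℂ h h) = 0 := by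
    rw [mul_left_comm, ← h1]
  exact (mul_eq_zero.mp h2).resolve_right hc0

/-- If the symbol fixes the origin, then the linear functions are eigenvectors of the adjoint of the
composition operator. -/
theorem IsCompositionOperator.adjoint_linear (hT : IsCompositionOperator Φ T) {P : ℂ → ℂ}
    (hP : AnalyticOnNhd ℂ P (Metric.ball 0 1)) (hΦP : ∀ z, (Φ z : ℂ) = P z) (hP0 : P 0 = 0)
    (h : H) : ContinuousLinearMap.adjoint T (Bergman.linear α h) =
      (starRingEnd ℂ (deriv P 0)) • Bergman.linear α h := by
  -- Tested against `f`, both sides read off a derivative at `0`, and `(f ∘ Φ)'(0) = Φ'(0) f'(0)`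
  -- because `Φ(0) = 0`. The eigenvalue is conjugated since it stands in the first slot of the inner
  -- product.
  refine ext_inner_right ℂ fun f => ?_
  obtain ⟨F, hF, hfF⟩ := f.analytic
  have hmaps : Set.MapsTo P (Metric.ball 0 1) (Metric.ball 0 1) := fun z hz => by
    rw [← hΦP ⟨z, hz⟩]
    exact (Φ ⟨z, hz⟩).2
  have h0 : (0 : ℂ) ∈ Metric.ball (0 : ℂ) 1 := Metric.mem_ball_self one_pos
  have hderiv : deriv (F ∘ P) 0 = deriv P 0 • deriv F 0 := by
    have := deriv.scomp (0 : ℂ) (h := P) (g₁ := F)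
      (by rw [hP0]; exact (hF 0 h0).differentiableAt) (hP 0 h0).differentiableAt
    rwa [hP0] at this
  rw [ContinuousLinearMap.adjoint_inner_left, inner_smul_left, Complex.conj_conj,
    Bergman.inner_linear h hF hfF, Bergman.inner_linear h (F := F ∘ P) (hF.comp hP hmaps)
      (fun z => by rw [hT, hfF, hΦP, Function.comp_apply]), hderiv, inner_smul_right]
  ring

/-- The symbol of a co-isometric composition operator is a rotation. -/
theorem IsCompositionOperator.eq_rotation_of_isCoisometry [Nontrivial H]
    (hT : IsCompositionOperator Φ T) (hco : IsCoisometry T)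
    (hΦ : DiscAnalytic (fun z => (Φ z : ℂ))) :
    ∃ c : ℂ, ‖c‖ = 1 ∧ ∀ z : Disc, (Φ z : ℂ) = c * z := by
  obtain ⟨P, hP, hΦP⟩ := hΦ
  have hP0 := hT.map_zero_of_isCoisometry hco hP hΦP
  obtain ⟨h, hh⟩ := exists_ne (0 : H)
  have hadj := hT.adjoint_linear hP hΦP hP0 h
  set a := starRingEnd ℂ (deriv P 0) with ha
  have hTT : T (ContinuousLinearMap.adjoint T (Bergman.linear α h)) = Bergman.linear α h :=
    DFunLike.congr_fun hco _
  have hnorm : ‖a‖ = 1 := by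
    have hne : Bergman.linear α h ≠ 0 := fun h0 => by
      have h1 : Bergman.linear α h ⟨1 / 2, by rw [mem_ball_zero_iff]; norm_num⟩ = 0 := by
        rw [h0]; rfl
      rw [Bergman.linear_apply, smul_eq_zero] at h1
      exact h1.elim (by norm_num) hh
    -- From `T T* = I`, the adjoint preserves the norm of the linear function, so its eigenvalue is
    -- unimodular.
    have h1 := ContinuousLinearMap.adjoint_inner_left T
      (ContinuousLinearMap.adjoint T (Bergman.linear α h)) (Bergman.linear α h)
    rw [hTT, inner_self_eq_norm_sq_to_K, inner_self_eq_norm_sq_to_K, hadj, norm_smul] at h1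
    have h2 : (‖a‖ * ‖Bergman.linear α h‖) ^ 2 = ‖Bergman.linear α h‖ ^ 2 := by exact_mod_cast h1
    have h3 := (sq_eq_sq₀ (by positivity) (norm_nonneg _)).mp h2
    exact mul_right_cancel₀ (norm_ne_zero_iff.mpr hne) (h3.trans (one_mul _).symm)
  have ha0 : a ≠ 0 := norm_ne_zero_iff.mp (by rw [hnorm]; exact one_ne_zero)
  -- Evaluating `T (a • ℓ_h) = ℓ_h` at `z` gives `(a Φ(z)) • h = z • h`, and `h ≠ 0` can be
  -- cancelled.
  refine ⟨a⁻¹, by rw [norm_inv, hnorm, inv_one], fun z => ?_⟩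
  rw [hadj, map_smul] at hTT
  have h1 : a • (T (Bergman.linear α h)) z = Bergman.linear α h z := by
    rw [← Bergman.smul_apply, hTT]
  rw [hT, Bergman.linear_apply, Bergman.linear_apply, smul_smul] at h1
  rw [← smul_left_injective ℂ hh h1, inv_mul_cancel_left₀ ha0]

variable (α H) in
/-- Composition with a rotation, as a unitary operator. -/
def rotationEquiv (u : Circle) : Bergman α H ≃ₗᵢ[ℂ] Bergman α H where
  toLinearEquiv := LinearEquiv.ofLinearMap (rotationLinearMap α H u) (rotationLinearMap α H u⁻¹)
    (LinearMap.ext fun f => rotationLinearMap_comp_inv u f)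
    (LinearMap.ext fun f => by simpa using rotationLinearMap_comp_inv u⁻¹ f)
  norm_map' f := by
    rw [Bergman.norm_eq, Bergman.norm_eq]
    exact congrArg ENNReal.toReal (eLpNorm_comp_measurePreserving
      f.memLp.aestronglyMeasurable (measurePreserving_rotate α u))

theorem exists_isCoisometry_of_eq_rotation {c : ℂ} (hc : ‖c‖ = 1)
    (hΦ : ∀ z : Disc, (Φ z : ℂ) = c * z) :
    ∃ T : Bergman α H →L[ℂ] Bergman α H, IsCompositionOperator Φ T ∧ IsCoisometry T := by
  set u : Circle := ⟨c, mem_sphere_zero_iff_norm.mpr hc⟩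
  refine ⟨(rotationEquiv α H u : Bergman α H →L[ℂ] Bergman α H), fun f z => ?_, ?_⟩
  · have hz : Φ z = Disc.rotate u z := Subtype.ext (hΦ z)
    rw [hz]
    rfl
  -- The adjoint of a unitary operator is its inverse.
  · rw [IsCoisometry, LinearIsometryEquiv.adjoint_eq_symm]
    exact ContinuousLinearMap.ext fun f => (rotationEquiv α H u).apply_symm_apply f

end Composition

end VVBergman

end

theorem mainTheorem2 (α : ℝ) [Fact (-1 < α)]
    (H : Type*) [NormedAddCommGroup H] [InnerProductSpace ℂ H] [CompleteSpace H]
    [TopologicalSpace.SeparableSpace H] [Nontrivial H]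
    (Φ : VVBergman.Disc → VVBergman.Disc)
    (hΦ : VVBergman.DiscAnalytic (fun z => (Φ z : ℂ))) :
    (∃ T : VVBergman.Bergman α H →L[ℂ] VVBergman.Bergman α H,
        VVBergman.IsCompositionOperator Φ T ∧ VVBergman.IsCoisometry T) ↔
      ∃ c : ℂ, ‖c‖ = 1 ∧ ∀ z : VVBergman.Disc, (Φ z : ℂ) = c * z := by
  constructor
  · rintro ⟨T, hT, hco⟩
    exact hT.eq_rotation_of_isCoisometry hco hΦ
  · rintro ⟨c, hc, hcΦ⟩
    exact VVBergman.exists_isCoisometry_of_eq_rotation hc hcΦ
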